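/- Let $K\ge 2$ and let $p=(p_{ij})_{1\le i,j\le K}$ be the transition matrix of an irreducible, aperiodic Markov chain on $\{1,\dots,K\}$. Fix a state $i_0$ (for instance $i_0=1$). Boxes are indexed by the finite words over $\{1,\dots,K\}$: the box of the empty word has type $i_0$ and size $1$, and a box of type $i$ and size $s$ is divided at the next generation into sub-boxes of types $k=1,\dots,K$ and sizes $s\,p_{ik}$; sub-boxes of size $0$ are discarded. Let $\underline l^{(n)}$ and $\overline l^{(n)}$ be the sizes of the smallest and of the largest box at generation $n$, that is, the minimum and the maximum of the (positive) sizes of the boxes of words of length $n$. For $\theta\in\mathbb R$ let $A(\theta)=(p_{ij}^\theta)_{i,j}$, with the convention $0^\theta=0$ for every $\theta$, and let $\rho(\theta)$ be the maximum modulus eigenvalue of $A(\theta)$, i.e. the real number that is a simple root of the characteristic polynomial of $A(\theta)$ and whose modulus is strictly larger than that of every other complex root. Then $\rho(\theta)$ exists for every $\theta$, $\rho$ is differentiable on $\mathbb R$ with $\rho'<0$, the minimum $\underline l^{(n)}$ and the maximum $\overline l^{(n)}$ are attained for every $n\ge 0$, the limits $$C_*=\lim_{\theta\to-\infty}\frac{\rho(\theta)}{-\rho'(\theta)},\qquad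 C^*=\lim_{\theta\to\infty}\frac{\rho(\theta)}{-\rho'(\theta)}$$ exist and satisfy $0<C_*\le C^*<\infty$, and $$\lim_{n\to\infty}\frac{\ln \underline l^{(n)}}{n}=-\frac1{C_*},\qquad \lim_{n\to\infty}\frac{\ln \overline l^{(n)}}{n}=-\frac1{C^*}.$$ -/

import Mathlib

open Filter Topology

namespace MarkovBoxes

noncomputable section

variable {K : ℕ}

/-- A transition matrix `p` is aperiodic if for every state `i` the greatest common divisor of the
possible return times `{n ≥ 1 : (p ^ n) i i > 0}` is one. -/
def IsAperiodic (p : Matrix (Fin K) (Fin K) ℝ) : Prop :=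
  ∀ i, Nat.setGcd {n : ℕ | 0 < n ∧ 0 < (p ^ n) i i} = 1

/-- Type of the box of a word `u = (i₁, …, iₙ)`: its last letter, and `i₀` for the empty word. -/
def boxType (i₀ : Fin K) : {n : ℕ} → (Fin n → Fin K) → Fin K
  | 0, _ => i₀
  | n + 1, u => u (Fin.last n)

/-- Size of the box of a word: the root box has size one, and a box of type `i` is divided into
sub-boxes, the one of type `k` having `p i k` times its size. -/
def boxSize (p : Matrix (Fin K) (Fin K) ℝ) (i₀ : Fin K) : {n : ℕ} → (Fin n → Fin K) → ℝ
  | 0, _ => 1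
  | n + 1, u => boxSize p i₀ (Fin.init u) * p (boxType i₀ (Fin.init u)) (u (Fin.last n))

theorem boxSize_snoc (p : Matrix (Fin K) (Fin K) ℝ) (i₀ : Fin K) {n : ℕ} (u : Fin n → Fin K)
    (k : Fin K) :
    boxSize p i₀ (Fin.snoc u k : Fin (n + 1) → Fin K)
      = boxSize p i₀ u * p (boxType i₀ u) k := by
  simp [boxSize]

/-- The set of sizes of the boxes that are present at generation `n`. Words with
`boxSize p i₀ u = 0` contain a forbidden transition and correspond to no box. -/
def boxSizes (p : Matrix (Fin K) (Fin K) ℝ) (i₀ : Fin K) (n : ℕ) : Set ℝ :=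
  {x | 0 < x ∧ ∃ u : Fin n → Fin K, boxSize p i₀ u = x}

/-- Size of the smallest box at generation `n`. -/
def smallestBox (p : Matrix (Fin K) (Fin K) ℝ) (i₀ : Fin K) (n : ℕ) : ℝ :=
  sInf (boxSizes p i₀ n)

/-- Size of the largest box at generation `n`. -/
def largestBox (p : Matrix (Fin K) (Fin K) ℝ) (i₀ : Fin K) (n : ℕ) : ℝ :=
  sSup (boxSizes p i₀ n)

/-- The matrix `A(θ) = (p_{ij} ^ θ)`, with the convention `0 ^ θ = 0` for every `θ`. -/
def powMatrix (p : Matrix (Fin K) (Fin K) ℝ) (θ : ℝ) : Matrix (Fin K) (Fin K) ℝ :=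
  Matrix.of fun i j => if p i j = 0 then 0 else p i j ^ θ

/-- `r` is a maximum modulus eigenvalue of `A`: it is a simple root of the (complex)
characteristic polynomial and its modulus is strictly larger than that of every other root. -/
def IsMaxModulusEigenvalue (A : Matrix (Fin K) (Fin K) ℝ) (r : ℝ) : Prop :=
  (A.map Complex.ofReal).charpoly.rootMultiplicity (r : ℂ) = 1 ∧
    ∀ z : ℂ, (A.map Complex.ofReal).charpoly.IsRoot z → z ≠ (r : ℂ) → ‖z‖ < |r|

theorem IsMaxModulusEigenvalue.unique {A : Matrix (Fin K) (Fin K) ℝ} {r s : ℝ}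
    (hr : IsMaxModulusEigenvalue A r) (hs : IsMaxModulusEigenvalue A s) : r = s := by
  by_contra hne
  have root : ∀ t : ℝ, IsMaxModulusEigenvalue A t →
      (A.map Complex.ofReal).charpoly.IsRoot (t : ℂ) := fun t ht =>
    (Polynomial.rootMultiplicity_pos (Matrix.charpoly_monic _).ne_zero).1 (by rw [ht.1]; norm_num)
  have h1 := hr.2 s (root s hs) (by exact_mod_cast Ne.symm hne)
  have h2 := hs.2 r (root r hr) (by exact_mod_cast hne)
  rw [Complex.norm_real, Real.norm_eq_abs] at h1 h2
  exact lt_asymm h1 h2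

open Classical in
/-- The maximum modulus eigenvalue of `A` (zero if there is none). -/
def maxModulusEigenvalue (A : Matrix (Fin K) (Fin K) ℝ) : ℝ :=
  if h : ∃ r : ℝ, IsMaxModulusEigenvalue A r then h.choose else 0

theorem IsMaxModulusEigenvalue.eq_maxModulusEigenvalue {A : Matrix (Fin K) (Fin K) ℝ} {r : ℝ}
    (hr : IsMaxModulusEigenvalue A r) : maxModulusEigenvalue A = r := by
  have h : ∃ r : ℝ, IsMaxModulusEigenvalue A r := ⟨r, hr⟩
  rw [maxModulusEigenvalue, dif_pos h]
  exact h.choose_spec.unique hr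

/-- `ρ(θ)`, the maximum modulus eigenvalue of `A(θ)`. -/
def rho (p : Matrix (Fin K) (Fin K) ℝ) (θ : ℝ) : ℝ :=
  maxModulusEigenvalue (powMatrix p θ)

end

end MarkovBoxes

/-! Summed over the boxes of generation n, the powers s^θ weighted by a function of the type form an
entry of A(θ)^n applied to that function (`sum_boxSize_rpow`). Weighted by the Perron eigenvector,
the sum is exactly ρ(θ)^n times a constant. There are at most K^n boxes, so the largest s^θ equals
ρ(θ)^n up to a factor K^n and a constant (`exists_log_boxSize_bounds`). For θ > 0 this concerns the
largest box, whose exponential rate is thus squeezed between (log ρ(θ) - log K)/θ and log ρ(θ)/θ;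
letting θ → ∞ removes log K. For θ < 0 the largest power belongs to the smallest box. The two rates
are therefore the limits of log ρ(θ)/θ at ±∞ (`tendsto_div_of_linear_bounds`).

These limits agree with those of ρ'/ρ because log ρ is convex (`convexOn_log_rho`): ρ'/ρ is
monotone, and log ρ(θ)/θ inherits its limits l ≤ L. The derivative formula bounds ρ'/ρ below, so l
is finite; L < 0 because some power of p has all its entries in (0, 1), which makes log ρ decay
linearly (`exists_log_rho_le`). The constants of the theorem are -1/l and -1/L.

Simplicity and strict dominance of ρ(θ) come from subtracting a rank-one matrix from a positive
power of A(θ) (`norm_lt_of_dotProduct_eq_zero`); differentiability comes from pairing a left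
eigenvector at one parameter with a right eigenvector at another (`rho_sub_mul`). -/

namespace Matrix.IsPrimitive

/-! ### Perron–Frobenius theory for primitive matrices. -/

/-- A positive matrix maps a nonzero nonnegative vector to a positive one. -/
theorem _root_.Matrix.mulVec_pos_of_pos {n : Type*} [Fintype n] {B : Matrix n n ℝ}
    (hB : ∀ i j, 0 < B i j) {x : n → ℝ} (hx : ∀ i, 0 ≤ x i) (hx0 : x ≠ 0) (i : n) : 0 < (B *ᵥ x) i := by
  obtain ⟨j, hj⟩ := Function.ne_iff.1 hx0
  exact Finset.sum_pos' (fun k _ => mul_nonneg (hB i k).le (hx k))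
    ⟨j, Finset.mem_univ j, mul_pos (hB i j) (lt_of_le_of_ne (hx j) (Ne.symm hj))⟩

variable {n : Type*} [Fintype n] [DecidableEq n] {A : Matrix n n ℝ}

theorem _root_.Matrix.pow_mulVec_of_mulVec {R : Type*} [CommRing R] {A : Matrix n n R} {r : R}
    {x : n → R} (h : A *ᵥ x = r • x) (k : ℕ) : (A ^ k) *ᵥ x = r ^ k • x := by
  induction k with
  | zero => simp
  | succ k ih => rw [pow_succ, ← mulVec_mulVec, h, mulVec_smul, ih, smul_smul, pow_succ, mul_comm]

theorem transpose (hA : A.IsPrimitive) : Aᵀ.IsPrimitive := by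
  obtain ⟨N, hN, hpos⟩ := hA.exists_pos_pow
  exact ⟨fun i j => hA.nonneg j i, N, hN, fun i j => by
    rw [← transpose_pow]; exact hpos j i⟩

/-- The maximal `t` such that `t x ≤ A x` for some `x` in the simplex. -/
theorem exists_maximal_subinvariant [Nonempty n] (A : Matrix n n ℝ) (hA : ∀ i j, 0 ≤ A i j) :
    ∃ t : ℝ, 0 ≤ t ∧ (∃ x ∈ stdSimplex ℝ n, ∀ i, t * x i ≤ (A *ᵥ x) i) ∧
      ∀ s : ℝ, 0 ≤ s → ∀ x ∈ stdSimplex ℝ n, (∀ i, s * x i ≤ (A *ᵥ x) i) → s ≤ t := by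
  have bound : ∀ s : ℝ, ∀ x ∈ stdSimplex ℝ n, (∀ i, s * x i ≤ (A *ᵥ x) i) →
      s ≤ ∑ i, ∑ j, A i j := fun s x hx h => by
    calc s = ∑ i, s * x i := by rw [← Finset.mul_sum, hx.2, mul_one]
      _ ≤ ∑ i, (A *ᵥ x) i := Finset.sum_le_sum fun i _ => h i
      _ ≤ ∑ i, ∑ j, A i j := Finset.sum_le_sum fun i _ => Finset.sum_le_sum fun j _ => by
        have hj : x j ≤ 1 := hx.2 ▸ Finset.single_le_sum (fun k _ => hx.1 k) (Finset.mem_univ j)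
        exact mul_le_of_le_one_right (hA i j) hj
  let S : Set (ℝ × (n → ℝ)) := (Set.Icc 0 (∑ i, ∑ j, A i j) ×ˢ stdSimplex ℝ n) ∩
    {q | ∀ i, q.1 * q.2 i ≤ (A *ᵥ q.2) i}
  have hS : IsCompact S := by
    refine (isCompact_Icc.prod (isCompact_stdSimplex ℝ n)).inter_right ?_
    simp only [Set.ofPred_forall]
    refine isClosed_iInter fun i => isClosed_le (by fun_prop) ?_
    simp only [mulVec, dotProduct]
    fun_prop
  obtain ⟨i₀⟩ := ‹Nonempty n›
  have hne : S.Nonempty := by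
    refine ⟨(0, Pi.single i₀ 1), ⟨⟨le_rfl, ?_⟩, single_mem_stdSimplex ℝ i₀⟩, fun i => ?_⟩
    · exact Finset.sum_nonneg fun i _ => Finset.sum_nonneg fun j _ => hA i j
    · simp [hA i i₀]
  obtain ⟨⟨t, x⟩, ⟨⟨ht, hx⟩, hle⟩, hmax⟩ := hS.exists_isMaxOn hne continuous_fst.continuousOn
  exact ⟨t, ht.1, ⟨x, hx, hle⟩, fun s hs y hy h =>
    hmax (show (s, y) ∈ S from ⟨⟨⟨hs, bound s y hy h⟩, hy⟩, h⟩)⟩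

/-- A primitive matrix has a positive eigenvector with positive eigenvalue. -/
theorem exists_pos_eigenvector [Nonempty n] (hA : A.IsPrimitive) :
    ∃ r : ℝ, 0 < r ∧ ∃ v : n → ℝ, (∀ i, 0 < v i) ∧ ∑ i, v i = 1 ∧ A *ᵥ v = r • v := by
  obtain ⟨N, hN, hpos⟩ := hA.exists_pos_pow
  obtain ⟨t, ht, ⟨x, hx, hle⟩, hmax⟩ := exists_maximal_subinvariant A hA.nonneg
  have hx0 : x ≠ 0 := by
    rintro rfl
    simpa using hx.2
  have hy : ∀ i, 0 < ((A ^ N) *ᵥ x) i := mulVec_pos_of_pos hpos hx.1 hx0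
  have heq : A *ᵥ x = t • x := by
    by_contra hne
    -- A nonzero defect becomes strictly positive under A^N, so y = A^N x satisfies A y ≥ (t + ε) y
    -- with ε > 0, against the maximality of t.
    have hz : ∀ i, 0 < ((A ^ N) *ᵥ (A *ᵥ x - t • x)) i :=
      mulVec_pos_of_pos hpos (fun i => by simpa using hle i) (sub_ne_zero.2 hne)
    set y := (A ^ N) *ᵥ x with hy_def
    have hzy : (A ^ N) *ᵥ (A *ᵥ x - t • x) = A *ᵥ y - t • y := by
      rw [mulVec_sub, mulVec_smul, mulVec_mulVec, hy_def, mulVec_mulVec, ← pow_succ, ← pow_succ']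
    obtain ⟨i₁, -, hi₁⟩ := Finset.exists_min_image Finset.univ
      (fun i => (A *ᵥ y - t • y) i / y i) Finset.univ_nonempty
    rw [hzy] at hz
    set ε := (A *ᵥ y - t • y) i₁ / y i₁ with hε
    have hεpos : 0 < ε := div_pos (hz i₁) (hy i₁)
    have hsum : 0 < ∑ i, y i := Finset.sum_pos (fun i _ => hy i) Finset.univ_nonempty
    have := hmax (t + ε) (by positivity) ((∑ i, y i)⁻¹ • y)
      ⟨fun i => mul_nonneg (inv_nonneg.2 hsum.le) (hy i).le, by
        simp only [Pi.smul_apply, smul_eq_mul]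
        rw [← Finset.mul_sum, inv_mul_cancel₀ hsum.ne']⟩ (fun i => by
        have h1 := hi₁ i (Finset.mem_univ i)
        rw [le_div_iff₀ (hy i)] at h1
        simp only [Pi.sub_apply, Pi.smul_apply, smul_eq_mul] at h1
        rw [mulVec_smul]
        simp only [Pi.smul_apply, smul_eq_mul]
        have h2 : (t + ε) * y i ≤ (A *ᵥ y) i := by linarith
        calc (t + ε) * ((∑ i, y i)⁻¹ * y i) = (∑ i, y i)⁻¹ * ((t + ε) * y i) := by ring
          _ ≤ _ := mul_le_mul_of_nonneg_left h2 (inv_nonneg.2 hsum.le))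
    linarith
  -- Positivity of A^N x = t^N x yields both t > 0 and x > 0.
  have hpow := pow_mulVec_of_mulVec heq N
  have hprod : ∀ i, 0 < t ^ N * x i := fun i => by simpa [hpow] using hy i
  have ht0 : 0 < t := by
    refine lt_of_le_of_ne ht fun h => ?_
    obtain ⟨i⟩ := ‹Nonempty n›
    simpa [← h, hN.ne'] using hprod i
  exact ⟨t, ht0, x, fun i => (mul_pos_iff_of_pos_left (pow_pos ht0 N)).1 (hprod i), hx.2, heq⟩

/-- The Perron eigenvalue of a primitive matrix with its right and left positive eigenvectors. -/
theorem exists_perron [Nonempty n] (hA : A.IsPrimitive) :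
    ∃ r : ℝ, 0 < r ∧ (∃ v : n → ℝ, (∀ i, 0 < v i) ∧ ∑ i, v i = 1 ∧ A *ᵥ v = r • v) ∧
      ∃ w : n → ℝ, (∀ i, 0 < w i) ∧ w ᵥ* A = r • w := by
  obtain ⟨r, hr, v, hv, hv1, hAv⟩ := hA.exists_pos_eigenvector
  obtain ⟨s, hs, w, hw, -, hAw⟩ := hA.transpose.exists_pos_eigenvector
  rw [mulVec_transpose] at hAw
  have hwv : 0 < w ⬝ᵥ v := Finset.sum_pos (fun i _ => mul_pos (hw i) (hv i)) Finset.univ_nonempty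
  have : s * (w ⬝ᵥ v) = r * (w ⬝ᵥ v) := by
    have h := dotProduct_mulVec w A v
    rw [hAv, hAw, dotProduct_smul, smul_dotProduct] at h
    simpa using h.symm
  rw [mul_right_cancel₀ hwv.ne' this] at hAw
  exact ⟨r, hr, ⟨v, hv, hv1, hAv⟩, w, hw, hAw⟩

/-- On the annihilator of the left Perron vector all eigenvalues are smaller than the Perron
eigenvalue. -/
theorem norm_lt_of_dotProduct_eq_zero [Nonempty n] (hA : A.IsPrimitive) {r : ℝ} (hr : 0 < r)
    {v w : n → ℝ} (hv : ∀ i, 0 < v i) (hw : ∀ i, 0 < w i) (hAw : w ᵥ* A = r • w)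
    {z : ℂ} {x : n → ℂ} (hx : x ≠ 0) (hwx : ∑ i, (w i : ℂ) * x i = 0)
    (hAx : A.map Complex.ofReal *ᵥ x = z • x) : ‖z‖ < r := by
  obtain ⟨N, hN, hpos⟩ := hA.exists_pos_pow
  obtain ⟨⟨a, b⟩, -, hab⟩ := Finset.exists_min_image (Finset.univ : Finset (n × n))
    (fun q => (A ^ N) q.1 q.2 / (v q.1 * w q.2)) Finset.univ_nonempty
  -- The largest ε for which A^N - ε v wᵀ stays nonnegative. Since w annihilates x, this smaller
  -- matrix still acts on x as z^N; pairing absolute values with w then gives ‖z‖^N ≤ r^N - ε (w·v).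
  set ε := (A ^ N) a b / (v a * w b) with hε
  have hεpos : 0 < ε := div_pos (hpos a b) (mul_pos (hv a) (hw b))
  have hB : ∀ i j, 0 ≤ (A ^ N) i j - ε * (v i * w j) := fun i j => by
    have h := hab (i, j) (Finset.mem_univ _)
    rw [le_div_iff₀ (mul_pos (hv i) (hw j))] at h
    linarith
  have hpx : ∀ i, ∑ j, ((A ^ N) i j : ℂ) * x j = z ^ N * x i := fun i => by
    have h := congrFun (pow_mulVec_of_mulVec hAx N) i
    have hmap : (A.map Complex.ofReal) ^ N = (A ^ N).map Complex.ofReal :=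
      (Matrix.map_pow A Complex.ofRealHom N).symm
    rw [hmap] at h
    simpa [mulVec, dotProduct] using h
  have hBx : ∀ i, ‖z‖ ^ N * ‖x i‖ ≤ ∑ j, ((A ^ N) i j - ε * (v i * w j)) * ‖x j‖ := fun i => by
    have h : z ^ N * x i = ∑ j, (((A ^ N) i j - ε * (v i * w j) : ℝ) : ℂ) * x j := by
      push_cast
      simp only [sub_mul, Finset.sum_sub_distrib, hpx, mul_assoc]
      simp only [← Finset.mul_sum, hwx, mul_zero, sub_zero]
    rw [← norm_pow, ← norm_mul, h]
    refine (norm_sum_le _ _).trans (Finset.sum_le_sum fun j _ => ?_)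
    rw [norm_mul, Complex.norm_real, Real.norm_eq_abs, abs_of_nonneg (hB i j)]
  have hwA : ∀ j, ∑ i, w i * (A ^ N) i j = r ^ N * w j := fun j => by
    have h := pow_mulVec_of_mulVec (A := Aᵀ) (r := r) (x := w) (by rw [mulVec_transpose, hAw]) N
    rw [← transpose_pow, mulVec_transpose] at h
    simpa [vecMul, dotProduct] using congrFun h j
  have hwv : 0 < ∑ i, w i * v i :=
    Finset.sum_pos (fun i _ => mul_pos (hw i) (hv i)) Finset.univ_nonempty
  have hwn : 0 < ∑ i, w i * ‖x i‖ := by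
    obtain ⟨j, hj⟩ := Function.ne_iff.1 hx
    exact Finset.sum_pos' (fun k _ => mul_nonneg (hw k).le (norm_nonneg _))
      ⟨j, Finset.mem_univ j, mul_pos (hw j) (norm_pos_iff.2 hj)⟩
  have key : ‖z‖ ^ N * ∑ i, w i * ‖x i‖
      ≤ (r ^ N - ε * ∑ i, w i * v i) * ∑ i, w i * ‖x i‖ := by
    calc ‖z‖ ^ N * ∑ i, w i * ‖x i‖ = ∑ i, w i * (‖z‖ ^ N * ‖x i‖) := by
          rw [Finset.mul_sum]; exact Finset.sum_congr rfl fun i _ => by ring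
      _ ≤ ∑ i, w i * ∑ j, ((A ^ N) i j - ε * (v i * w j)) * ‖x j‖ :=
          Finset.sum_le_sum fun i _ => mul_le_mul_of_nonneg_left (hBx i) (hw i).le
      _ = ∑ j, (∑ i, w i * (A ^ N) i j - ε * (∑ i, w i * v i) * w j) * ‖x j‖ := by
          simp only [Finset.mul_sum, Finset.sum_mul, sub_mul, mul_sub, Finset.sum_sub_distrib]
          rw [Finset.sum_comm]
          congr 1
          · exact Finset.sum_congr rfl fun j _ => Finset.sum_congr rfl fun i _ => by ring
          · rw [Finset.sum_comm]
            exact Finset.sum_congr rfl fun j _ => Finset.sum_congr rfl fun i _ => by ring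
      _ = (r ^ N - ε * ∑ i, w i * v i) * ∑ i, w i * ‖x i‖ := by
          rw [Finset.mul_sum Finset.univ (fun i => w i * ‖x i‖)]
          exact Finset.sum_congr rfl fun j _ => by rw [hwA]; ring
  have h1 := le_of_mul_le_mul_right key hwn
  have h2 : ‖z‖ ^ N < r ^ N := by nlinarith [mul_pos hεpos hwv]
  exact lt_of_pow_lt_pow_left₀ N hr.le h2

/-- Nonnegative normalized eigenvectors for the Perron eigenvalue are unique. -/
theorem eigenvector_unique [Nonempty n] (hA : A.IsPrimitive) {r : ℝ} (hr : 0 < r)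
    {v w : n → ℝ} (hv : ∀ i, 0 < v i) (hv1 : ∑ i, v i = 1) (hAv : A *ᵥ v = r • v)
    (hw : ∀ i, 0 < w i) (hAw : w ᵥ* A = r • w) {x : n → ℝ} (hx1 : ∑ i, x i = 1)
    (hAx : A *ᵥ x = r • x) : x = v := by
  have hwv : 0 < w ⬝ᵥ v := Finset.sum_pos (fun i _ => mul_pos (hw i) (hv i)) Finset.univ_nonempty
  -- Chosen so that w annihilates x - c v; a nonzero difference would be an eigenvector for r there,
  -- where all eigenvalues are smaller than r in modulus.
  set c := (w ⬝ᵥ x) / (w ⬝ᵥ v) with hc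
  have hzero : x - c • v = 0 := by
    by_contra hne
    have hAy : A *ᵥ (x - c • v) = r • (x - c • v) := by
      rw [mulVec_sub, mulVec_smul, hAx, hAv, smul_sub, smul_comm]
    have := hA.norm_lt_of_dotProduct_eq_zero (z := r) (x := fun i => ((x - c • v) i : ℂ)) hr hv
      hw hAw
      (fun h => hne (funext fun i => Complex.ofReal_eq_zero.1 (congrFun h i)))
      (by
        have h : w ⬝ᵥ (x - c • v) = 0 := by
          rw [dotProduct_sub, dotProduct_smul, hc, smul_eq_mul, div_mul_cancel₀ _ hwv.ne', sub_self]
        simp only [dotProduct] at h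
        exact_mod_cast h)
      (funext fun i => by
        have h := congrFun hAy i
        simp only [mulVec, dotProduct, Pi.smul_apply, smul_eq_mul, map_apply] at h ⊢
        exact_mod_cast h)
    rw [Complex.norm_real, Real.norm_eq_abs, abs_of_pos hr] at this
    exact lt_irrefl _ this
  have hxc : x = c • v := sub_eq_zero.1 hzero
  have : c = 1 := by
    rw [hxc] at hx1
    simpa [← Finset.mul_sum, hv1] using hx1
  rw [hxc, this, one_smul]

/-- The Perron eigenvalue is a simple root of the characteristic polynomial and dominates the
other roots. -/
theorem isMaxModulusEigenvalue {K : ℕ} [NeZero K] {A : Matrix (Fin K) (Fin K) ℝ}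
    (hA : A.IsPrimitive) {r : ℝ} (hr : 0 < r) {v w : Fin K → ℝ} (hv : ∀ i, 0 < v i)
    (hAv : A *ᵥ v = r • v) (hw : ∀ i, 0 < w i) (hAw : w ᵥ* A = r • w) :
    MarkovBoxes.IsMaxModulusEigenvalue A r := by
  set B : Matrix (Fin K) (Fin K) ℂ := A.map Complex.ofReal with hB
  set f : Module.End ℂ (Fin K → ℂ) := Matrix.toLin' B with hf
  have hfB : ∀ x, f x = B *ᵥ x := fun x => Matrix.toLin'_apply B x
  have hchar : B.charpoly = f.charpoly := (Matrix.charpoly_toLin' B).symm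
  have hwB : ∀ x : Fin K → ℂ, ∑ i, (w i : ℂ) * f x i = r * ∑ i, (w i : ℂ) * x i := fun x => by
    have h1 : ∀ j, ∑ i, (w i : ℂ) * A i j = r * w j := fun j => by
      have := congrFun hAw j
      simp only [vecMul, dotProduct, Pi.smul_apply, smul_eq_mul] at this
      exact_mod_cast this
    simp only [hfB, hB, mulVec, dotProduct, map_apply, Finset.mul_sum]
    rw [Finset.sum_comm]
    refine Finset.sum_congr rfl fun j _ => ?_
    rw [← mul_assoc, ← h1 j, Finset.sum_mul]
    exact Finset.sum_congr rfl fun i _ => by ring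
  set v' : Fin K → ℂ := fun i => v i with hv'
  have hfv : f v' = (r : ℂ) • v' := by
    rw [hfB]
    ext i
    have := congrFun hAv i
    simp only [hB, hv', mulVec, dotProduct, Pi.smul_apply, smul_eq_mul, map_apply] at this ⊢
    exact_mod_cast this
  have hwv : ∑ i, (w i : ℂ) * v' i ≠ 0 := by
    have : 0 < ∑ i, w i * v i :=
      Finset.sum_pos (fun i _ => mul_pos (hw i) (hv i)) Finset.univ_nonempty
    simp only [hv']
    exact_mod_cast this.ne'
  have hv0 : v' ≠ 0 := by
    rintro h
    simp [h] at hwv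
  -- The kernel of w is f-invariant and f - r is injective on it. Subtracting a multiple of v'
  -- brings any generalized eigenvector into this kernel, so the generalized eigenspace is a line.
  have inj : ∀ (k : ℕ) (y : Fin K → ℂ), ∑ i, (w i : ℂ) * y i = 0 →
      ((f - algebraMap ℂ (Module.End ℂ (Fin K → ℂ)) r) ^ k) y = 0 → y = 0 := by
    intro k
    induction k with
    | zero => intro y _ h; simpa using h
    | succ k ih =>
      intro y hy h
      rw [pow_succ, Module.End.mul_apply] at h
      have h0 := ih _ (by
        simp only [LinearMap.sub_apply, Module.algebraMap_end_apply, Pi.sub_apply, Pi.smul_apply,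
          smul_eq_mul, mul_sub, Finset.sum_sub_distrib, hwB, hy, mul_zero, zero_sub, neg_eq_zero]
        rw [← mul_zero (r : ℂ), ← hy, Finset.mul_sum]
        exact Finset.sum_congr rfl fun i _ => by ring) h
      by_contra hne
      have hfy : B *ᵥ y = (r : ℂ) • y := by
        rw [← hfB]
        simpa [sub_eq_zero] using h0
      have := hA.norm_lt_of_dotProduct_eq_zero hr hv hw hAw hne hy hfy
      rw [Complex.norm_real, Real.norm_eq_abs, abs_of_pos hr] at this
      exact lt_irrefl _ this
  refine ⟨?_, fun z hz hne => ?_⟩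
  · rw [hchar, ← LinearMap.finrank_maxGenEigenspace_eq]
    have hspan : f.maxGenEigenspace (r : ℂ) = ℂ ∙ v' := by
      have hmem : v' ∈ f.maxGenEigenspace (r : ℂ) :=
        Module.End.mem_maxGenEigenspace f (r : ℂ) v' |>.2 ⟨1, by simp [hfv]⟩
      refine le_antisymm (fun x hx => ?_) ((Submodule.span_singleton_le_iff_mem _ _).2 hmem)
      set c := (∑ i, (w i : ℂ) * x i) / ∑ i, (w i : ℂ) * v' i with hc
      have hsub := Submodule.sub_mem _ hx (Submodule.smul_mem _ c hmem)
      obtain ⟨k, hk⟩ := (Module.End.mem_maxGenEigenspace f (r : ℂ) _).1 hsub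
      have := inj k (x - c • v') (by
        simp only [Pi.sub_apply, Pi.smul_apply, smul_eq_mul, mul_sub, Finset.sum_sub_distrib,
          mul_left_comm _ c, ← Finset.mul_sum]
        rw [hc, div_mul_cancel₀ _ hwv, sub_self]) hk
      exact Submodule.mem_span_singleton.2 ⟨c, (sub_eq_zero.1 this).symm⟩
    rw [hspan, finrank_span_singleton hv0]
  · rw [hchar, ← Module.End.hasEigenvalue_iff_isRoot_charpoly] at hz
    obtain ⟨x, hx⟩ := hz.exists_hasEigenvector
    have hfx : f x = z • x := hx.apply_eq_smul
    rw [abs_of_pos hr]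
    refine hA.norm_lt_of_dotProduct_eq_zero hr hv hw hAw hx.2 ?_ ((hfB x).symm.trans hfx)
    -- Pairing with w gives z (w·x) = r (w·x), so z ≠ r forces w·x = 0.
    have h := hwB x
    rw [hfx] at h
    simp only [Pi.smul_apply, smul_eq_mul, mul_left_comm _ z, ← Finset.mul_sum] at h
    exact (mul_eq_mul_right_iff.1 h).resolve_left hne

end Matrix.IsPrimitive

/-! ### Primitivity of p and of A(θ), and existence of ρ. -/

namespace MarkovBoxes

variable {K : ℕ}

/-- An irreducible aperiodic matrix is primitive. -/
theorem isPrimitive_of_isIrreducible_of_isAperiodic {p : Matrix (Fin K) (Fin K) ℝ}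
    (hirr : p.IsIrreducible) (haper : IsAperiodic p) : p.IsPrimitive := by
  have hnn : ∀ (m : ℕ) i j, 0 ≤ (p ^ m) i j := fun m => Matrix.pow_apply_nonneg hirr.nonneg m
  have hmul : ∀ (a b : ℕ) (i j k : Fin K), 0 < (p ^ a) i j → 0 < (p ^ b) j k →
      0 < (p ^ (a + b)) i k := fun a b i j k h1 h2 => by
    rw [pow_add, Matrix.mul_apply]
    exact Finset.sum_pos' (fun l _ => mul_nonneg (hnn _ _ _) (hnn _ _ _))
      ⟨j, Finset.mem_univ j, mul_pos h1 h2⟩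
  have hret : ∀ i, ∃ N, ∀ m ≥ N, 0 < (p ^ m) i i := fun i => by
    -- The additive monoid generated by the return times contains all large multiples of their gcd,
    -- here 1, and return times are closed under addition.
    obtain ⟨N, hN⟩ := Nat.exists_mem_closure_of_ge {n : ℕ | 0 < n ∧ 0 < (p ^ n) i i}
    refine ⟨N, fun m hm => ?_⟩
    have := hN m hm (by rw [haper i]; exact one_dvd m)
    clear hm
    induction this using AddSubmonoid.closure_induction with
    | mem x hx => exact hx.2
    | zero => simp
    | add x y _ _ hx hy => exact hmul _ _ _ _ _ hx hy
  choose N hN using hret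
  choose d _ hd using (Matrix.isIrreducible_iff_exists_pow_pos hirr.nonneg).1 hirr
  -- A uniform exponent: after reserving d i j steps from i to j, at least N i steps remain for
  -- returning to i. The `+ 1` keeps it positive.
  refine ⟨hirr.nonneg, (∑ i, N i) + (∑ i, ∑ j, d i j) + 1, by positivity, fun i j => ?_⟩
  have h1 : N i ≤ ∑ i, N i := Finset.single_le_sum (fun _ _ => Nat.zero_le _) (Finset.mem_univ i)
  have h2 : d i j ≤ ∑ i, ∑ j, d i j :=
    (Finset.single_le_sum (f := fun j => d i j) (fun _ _ => Nat.zero_le _)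
      (Finset.mem_univ j)).trans
      (Finset.single_le_sum (f := fun i => ∑ j, d i j) (fun _ _ => Nat.zero_le _)
        (Finset.mem_univ i))
  have := hmul ((∑ i, N i) + (∑ i, ∑ j, d i j) + 1 - d i j) (d i j) i i j
    (hN i _ (by omega)) (hd i j)
  rwa [Nat.sub_add_cancel (by omega)] at this

theorem powMatrix_apply (p : Matrix (Fin K) (Fin K) ℝ) (θ : ℝ) (i j : Fin K) :
    powMatrix p θ i j = if p i j = 0 then 0 else p i j ^ θ := rfl

theorem powMatrix_nonneg {p : Matrix (Fin K) (Fin K) ℝ} (hp : ∀ i j, 0 ≤ p i j) (θ : ℝ)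
    (i j : Fin K) : 0 ≤ powMatrix p θ i j := by
  rw [powMatrix_apply]
  split_ifs
  exacts [le_rfl, Real.rpow_nonneg (hp i j) θ]

theorem powMatrix_pos {p : Matrix (Fin K) (Fin K) ℝ} (θ : ℝ)
    {i j : Fin K} (h : 0 < p i j) : 0 < powMatrix p θ i j := by
  rw [powMatrix_apply, if_neg h.ne']
  exact Real.rpow_pos_of_pos h θ

theorem powMatrix_pow_pos {p : Matrix (Fin K) (Fin K) ℝ} (hp : ∀ i j, 0 ≤ p i j) (θ : ℝ) (m : ℕ)
    (i j : Fin K) (h : 0 < (p ^ m) i j) : 0 < (powMatrix p θ ^ m) i j := by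
  induction m generalizing j with
  | zero => simpa using h
  | succ m ih =>
    rw [pow_succ, Matrix.mul_apply] at h ⊢
    obtain ⟨k, -, hk⟩ := Finset.exists_lt_of_sum_lt (f := fun _ => (0 : ℝ)) (by simpa using h)
    have h1 : 0 < (p ^ m) i k := pos_of_mul_pos_left hk (hp k j)
    exact Finset.sum_pos' (fun l _ => mul_nonneg
      (Matrix.pow_apply_nonneg (powMatrix_nonneg hp θ) m i l) (powMatrix_nonneg hp θ l j))
      ⟨k, Finset.mem_univ k, mul_pos (ih k h1)
        (powMatrix_pos θ (pos_of_mul_pos_right hk h1.le))⟩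

theorem isPrimitive_powMatrix {p : Matrix (Fin K) (Fin K) ℝ} (hp : p.IsPrimitive) (θ : ℝ) :
    (powMatrix p θ).IsPrimitive := by
  obtain ⟨N, hN, hpos⟩ := hp.exists_pos_pow
  exact ⟨powMatrix_nonneg hp.nonneg θ, N, hN, fun i j =>
    powMatrix_pow_pos hp.nonneg θ N i j (hpos i j)⟩

/-- Existence and dominance of `ρ(θ)`, together with its positive eigenvectors. -/
theorem rho_spec [NeZero K] {p : Matrix (Fin K) (Fin K) ℝ} (hp : p.IsPrimitive) (θ : ℝ) :
    IsMaxModulusEigenvalue (powMatrix p θ) (rho p θ) ∧ 0 < rho p θ ∧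
      (∃ v : Fin K → ℝ, (∀ i, 0 < v i) ∧ ∑ i, v i = 1 ∧
        (powMatrix p θ).mulVec v = rho p θ • v) ∧
      ∃ w : Fin K → ℝ, (∀ i, 0 < w i) ∧ Matrix.vecMul w (powMatrix p θ) = rho p θ • w := by
  have hA := isPrimitive_powMatrix hp θ
  obtain ⟨r, hr, ⟨v, hv, hv1, hAv⟩, w, hw, hAw⟩ := hA.exists_perron
  have hmax := hA.isMaxModulusEigenvalue hr hv hAv hw hAw
  have hrho : rho p θ = r := hmax.eq_maxModulusEigenvalue
  rw [hrho]
  exact ⟨hmax, hr, ⟨v, hv, hv1, hAv⟩, w, hw, hAw⟩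

/-! ### Continuity and differentiability of ρ. -/

theorem hasDerivAt_powMatrix {p : Matrix (Fin K) (Fin K) ℝ} (hp : ∀ i j, 0 ≤ p i j) (θ : ℝ)
    (i j : Fin K) : HasDerivAt (fun φ => powMatrix p φ i j)
      (powMatrix p θ i j * Real.log (p i j)) θ := by
  simp only [powMatrix_apply]
  split_ifs with h
  · simpa using hasDerivAt_const θ (0 : ℝ)
  · have := (hasDerivAt_id θ).const_rpow (lt_of_le_of_ne (hp i j) (Ne.symm h))
    simpa [mul_comm] using this

/-- Perturbation identity for the Perron eigenvalue. -/
theorem rho_sub_mul {p : Matrix (Fin K) (Fin K) ℝ} {θ φ : ℝ} {w v : Fin K → ℝ}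
    (hw : Matrix.vecMul w (powMatrix p θ) = rho p θ • w)
    (hv : (powMatrix p φ).mulVec v = rho p φ • v) :
    (rho p φ - rho p θ) * ∑ i, w i * v i
      = ∑ i, ∑ j, w i * (powMatrix p φ i j - powMatrix p θ i j) * v j := by
  have h1 : dotProduct w ((powMatrix p φ).mulVec v) = rho p φ * ∑ i, w i * v i := by
    rw [hv, dotProduct_smul, smul_eq_mul]; rfl
  have h2 : dotProduct w ((powMatrix p θ).mulVec v) = rho p θ * ∑ i, w i * v i := by
    rw [Matrix.dotProduct_mulVec, hw, smul_dotProduct, smul_eq_mul]; rfl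
  rw [sub_mul, ← h1, ← h2]
  simp only [dotProduct, Matrix.mulVec, Finset.mul_sum, mul_sub, sub_mul, Finset.sum_sub_distrib,
    mul_assoc]

theorem le_one_of_sum_eq_one {v : Fin K → ℝ} (hv : ∀ i, 0 < v i) (hv1 : ∑ i, v i = 1)
    (i : Fin K) : v i ≤ 1 :=
  hv1 ▸ Finset.single_le_sum (fun k _ => (hv k).le) (Finset.mem_univ i)

/-- In `rho_sub_mul` keep the left eigenvector w at θ fixed. Normalization of v gives w·v ≥ min w >
0 uniformly in φ, so entrywise continuity of A suffices. -/
theorem continuousAt_rho [NeZero K] {p : Matrix (Fin K) (Fin K) ℝ} (hp : p.IsPrimitive) (θ : ℝ) :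
    ContinuousAt (rho p) θ := by
  obtain ⟨-, -, -, w, hw, hAw⟩ := rho_spec hp θ
  obtain ⟨i₁, -, hi₁⟩ := Finset.exists_min_image Finset.univ w Finset.univ_nonempty
  have hbound : ∀ φ, |rho p φ - rho p θ|
      ≤ (∑ i, ∑ j, w i * |powMatrix p φ i j - powMatrix p θ i j|) / w i₁ := fun φ => by
    obtain ⟨-, -, ⟨v, hv, hv1, hAv⟩, -⟩ := rho_spec hp φ
    have hwv : w i₁ ≤ ∑ i, w i * v i := by
      calc w i₁ = ∑ i, w i₁ * v i := by rw [← Finset.mul_sum, hv1, mul_one]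
        _ ≤ _ := Finset.sum_le_sum fun i hi => mul_le_mul_of_nonneg_right (hi₁ i hi) (hv i).le
    rw [le_div_iff₀ (hw i₁)]
    calc |rho p φ - rho p θ| * w i₁ ≤ |rho p φ - rho p θ| * ∑ i, w i * v i :=
          mul_le_mul_of_nonneg_left hwv (abs_nonneg _)
      _ = |∑ i, ∑ j, w i * (powMatrix p φ i j - powMatrix p θ i j) * v j| := by
          rw [← rho_sub_mul hAw hAv, abs_mul, abs_of_pos ((hw i₁).trans_le hwv)]
      _ ≤ ∑ i, ∑ j, |w i * (powMatrix p φ i j - powMatrix p θ i j) * v j| :=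
          (Finset.abs_sum_le_sum_abs _ _).trans
            (Finset.sum_le_sum fun i _ => Finset.abs_sum_le_sum_abs _ _)
      _ ≤ _ := Finset.sum_le_sum fun i _ => Finset.sum_le_sum fun j _ => by
          rw [abs_mul, abs_mul, abs_of_pos (hw i), abs_of_pos (hv j)]
          exact mul_le_of_le_one_right (mul_nonneg (hw i).le (abs_nonneg _))
            (le_one_of_sum_eq_one hv hv1 j)
  have hcont : ∀ i j, ContinuousAt (fun φ => powMatrix p φ i j) θ := fun i j =>
    (hasDerivAt_powMatrix hp.nonneg θ i j).continuousAt
  have hlim : ContinuousAt (fun φ =>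
      (∑ i, ∑ j, w i * |powMatrix p φ i j - powMatrix p θ i j|) / w i₁) θ := by
    fun_prop
  rw [ContinuousAt, tendsto_iff_dist_tendsto_zero]
  refine squeeze_zero (fun _ => dist_nonneg) (fun φ => (Real.dist_eq _ _).trans_le (hbound φ)) ?_
  simpa using hlim.tendsto

/-- Normalized Perron eigenvectors depend continuously on the parameter. -/
theorem tendsto_eigenvector [NeZero K] {p : Matrix (Fin K) (Fin K) ℝ} (hp : p.IsPrimitive)
    (θ : ℝ) {V : ℝ → Fin K → ℝ} (hV : ∀ φ i, 0 < V φ i) (hV1 : ∀ φ, ∑ i, V φ i = 1)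
    (hAV : ∀ φ, (powMatrix p φ).mulVec (V φ) = rho p φ • V φ) : Tendsto V (𝓝 θ) (𝓝 (V θ)) := by
  obtain ⟨-, hr, -, w, hw, hAw⟩ := rho_spec hp θ
  -- By compactness of the simplex it is enough that each cluster point is an eigenvector of A(θ)
  -- for ρ(θ), as such a normalized vector is unique.
  refine (isCompact_stdSimplex ℝ (Fin K)).tendsto_nhds_of_unique_mapClusterPt
    (Eventually.of_forall fun φ => ⟨fun i => (hV φ i).le, hV1 φ⟩) fun x hx hcl => ?_
  refine (isPrimitive_powMatrix hp θ).eigenvector_unique hr (hV θ) (hV1 θ) (hAV θ) hw hAw hx.2 ?_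
  have hbdd : ∀ i, IsBoundedUnder (· ≤ ·) (𝓝 θ) (norm ∘ fun φ => V φ i) := fun i =>
    isBoundedUnder_of ⟨1, fun φ => by
      simp only [Function.comp, Real.norm_eq_abs, abs_of_pos (hV φ i)]
      exact le_one_of_sum_eq_one (hV φ) (hV1 φ) i⟩
  set g : (Fin K → ℝ) → Fin K → ℝ := fun y => (powMatrix p θ).mulVec y - rho p θ • y with hg
  have hgc : Continuous g := by
    simp only [hg]
    exact (continuous_const.matrix_mulVec continuous_id).sub (continuous_const_smul _)
  have hlim : Tendsto (g ∘ V) (𝓝 θ) (𝓝 0) := by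
    refine tendsto_pi_nhds.2 fun i => ?_
    have heq : ∀ φ, (g ∘ V) φ i = (∑ j, (powMatrix p θ i j - powMatrix p φ i j) * V φ j)
        + (rho p φ - rho p θ) * V φ i := fun φ => by
      have h := congrFun (hAV φ) i
      simp only [Matrix.mulVec, dotProduct, Pi.smul_apply, smul_eq_mul] at h
      simp only [hg, Function.comp, Matrix.mulVec, dotProduct, Pi.sub_apply, Pi.smul_apply,
        smul_eq_mul, sub_mul, Finset.sum_sub_distrib, h]
      ring
    simp only [heq]
    have h1 : Tendsto (fun φ => (rho p φ - rho p θ) * V φ i) (𝓝 θ) (𝓝 0) := by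
      refine Tendsto.zero_mul_isBoundedUnder_le ?_ (hbdd i)
      simpa using (continuousAt_rho hp θ).tendsto.sub_const (rho p θ)
    have h2 : ∀ j, Tendsto (fun φ => (powMatrix p θ i j - powMatrix p φ i j) * V φ j) (𝓝 θ)
        (𝓝 0) := fun j => by
      refine Tendsto.zero_mul_isBoundedUnder_le ?_ (hbdd j)
      simpa using (hasDerivAt_powMatrix hp.nonneg θ i j).continuousAt.tendsto.const_sub
        (powMatrix p θ i j)
    simpa using (tendsto_finsetSum Finset.univ fun j _ => h2 j).add h1
  have hcl' : MapClusterPt (g x) (𝓝 θ) (g ∘ V) := hcl.continuousAt_comp hgc.continuousAt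
  have h0 : g x = 0 := by
    have : (𝓝 (g x) ⊓ 𝓝 0).NeBot := hcl'.neBot.mono (inf_le_inf_left _ hlim)
    exact eq_of_nhds_neBot this
  exact sub_eq_zero.1 h0

/-- Differentiability of the Perron eigenvalue with the usual formula for the derivative. -/
theorem exists_hasDerivAt_rho [NeZero K] {p : Matrix (Fin K) (Fin K) ℝ} (hp : p.IsPrimitive)
    (θ : ℝ) : ∃ v w : Fin K → ℝ, (∀ i, 0 < v i) ∧ (∀ i, 0 < w i) ∧
      (powMatrix p θ).mulVec v = rho p θ • v ∧
      HasDerivAt (rho p) ((∑ i, ∑ j, w i * (powMatrix p θ i j * Real.log (p i j)) * v j) /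
        ∑ i, w i * v i) θ := by
  choose V hV hV1 hAV using fun φ => (rho_spec hp φ).2.2.1
  obtain ⟨-, -, -, w, hw, hAw⟩ := rho_spec hp θ
  refine ⟨V θ, w, hV θ, hw, hAV θ, ?_⟩
  have hwV : ∀ φ, 0 < ∑ i, w i * V φ i := fun φ =>
    Finset.sum_pos (fun i _ => mul_pos (hw i) (hV φ i)) Finset.univ_nonempty
  have hVt : ∀ i, Tendsto (fun φ => V φ i) (𝓝[≠] θ) (𝓝 (V θ i)) := fun i =>
    (tendsto_pi_nhds.1 (tendsto_eigenvector hp θ hV hV1 hAV) i).mono_left inf_le_left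
  rw [hasDerivAt_iff_tendsto_slope]
  -- Only the right eigenvector moves with φ, so its continuity, not its differentiability, is what
  -- the limit needs.
  have heq : ∀ φ, slope (rho p) θ φ = (∑ i, ∑ j, w i *
      slope (fun φ => powMatrix p φ i j) θ φ * V φ j) / ∑ i, w i * V φ i := fun φ => by
    rw [eq_div_iff (hwV φ).ne', slope_def_field, div_mul_eq_mul_div, rho_sub_mul hAw (hAV φ)]
    simp only [Finset.sum_div, slope_def_field]
    exact Finset.sum_congr rfl fun i _ => Finset.sum_congr rfl fun j _ => by ring
  simp only [funext heq]
  refine Tendsto.div ?_ ?_ (hwV θ).ne'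
  · exact tendsto_finsetSum _ fun i _ => tendsto_finsetSum _ fun j _ =>
      ((hasDerivAt_iff_tendsto_slope.1 (hasDerivAt_powMatrix hp.nonneg θ i j)).const_mul _).mul
        (hVt j)
  · exact tendsto_finsetSum _ fun i _ => (hVt i).const_mul _

theorem differentiable_rho [NeZero K] {p : Matrix (Fin K) (Fin K) ℝ} (hp : p.IsPrimitive) :
    Differentiable ℝ (rho p) := fun θ => by
  obtain ⟨v, w, -, -, -, h⟩ := exists_hasDerivAt_rho hp θ
  exact h.differentiableAt

/-- The logarithmic derivative of `ρ` is at least the minimum of the logarithms of the entries. -/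
theorem exists_le_deriv_rho_div_rho [NeZero K] {p : Matrix (Fin K) (Fin K) ℝ}
    (hp : p.IsPrimitive) : ∃ m : ℝ, ∀ θ, m ≤ deriv (rho p) θ / rho p θ := by
  -- Zero entries enter this minimum with the value log 0 = 0; this is harmless, since they carry
  -- weight zero in the derivative formula and can only lower the bound.
  obtain ⟨⟨a, b⟩, -, hab⟩ := Finset.exists_min_image (Finset.univ : Finset (Fin K × Fin K))
    (fun q => Real.log (p q.1 q.2)) Finset.univ_nonempty
  refine ⟨Real.log (p a b), fun θ => ?_⟩
  obtain ⟨v, w, hv, hw, hAv, h⟩ := exists_hasDerivAt_rho hp θ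
  have hwv : 0 < ∑ i, w i * v i :=
    Finset.sum_pos (fun i _ => mul_pos (hw i) (hv i)) Finset.univ_nonempty
  rw [h.deriv, le_div_iff₀ (rho_spec hp θ).2.1, le_div_iff₀ hwv, mul_assoc, Finset.mul_sum,
    Finset.mul_sum]
  refine Finset.sum_le_sum fun i _ => ?_
  have hi := congrFun hAv i
  simp only [Matrix.mulVec, dotProduct, Pi.smul_apply, smul_eq_mul] at hi
  rw [mul_left_comm (rho p θ), ← hi, Finset.mul_sum, Finset.mul_sum]
  refine Finset.sum_le_sum fun j _ => ?_
  have h1 := hab (i, j) (Finset.mem_univ _)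
  have h2 : 0 ≤ w i * powMatrix p θ i j * v j :=
    mul_nonneg (mul_nonneg (hw i).le (powMatrix_nonneg hp.nonneg θ i j)) (hv j).le
  nlinarith [mul_le_mul_of_nonneg_left h1 h2]

/-! ### Log-convexity of ρ. -/

/-- A positive supersolution bounds the Perron eigenvalue from above. -/
theorem rho_le_of_mulVec_le [NeZero K] {p : Matrix (Fin K) (Fin K) ℝ} (hp : p.IsPrimitive) {θ s : ℝ}
    {x : Fin K → ℝ} (hx : ∀ i, 0 < x i) (h : ∀ i, (powMatrix p θ).mulVec x i ≤ s * x i) :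
    rho p θ ≤ s := by
  obtain ⟨-, -, -, w, hw, hAw⟩ := rho_spec hp θ
  have hwx : 0 < dotProduct w x :=
    Finset.sum_pos (fun i _ => mul_pos (hw i) (hx i)) Finset.univ_nonempty
  refine le_of_mul_le_mul_right ?_ hwx
  calc rho p θ * dotProduct w x = dotProduct w ((powMatrix p θ).mulVec x) := by
        rw [Matrix.dotProduct_mulVec, hAw, smul_dotProduct, smul_eq_mul]
    _ ≤ dotProduct w (s • x) :=
        Finset.sum_le_sum fun i _ => mul_le_mul_of_nonneg_left (h i) (hw i).le
    _ = s * dotProduct w x := by rw [dotProduct_smul, smul_eq_mul]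

/-- The geometric interpolation v^a u^b of the two eigenvectors is a supersolution with factor
ρ(θ)^a ρ(φ)^b: this is Hölder's inequality, obtained from weighted AM-GM on terms normalized so that
each row sums to one. -/
theorem convexOn_log_rho [NeZero K] {p : Matrix (Fin K) (Fin K) ℝ} (hp : p.IsPrimitive) :
    ConvexOn ℝ Set.univ fun θ => Real.log (rho p θ) := by
  refine ⟨convex_univ, fun θ _ φ _ a b ha hb hab => ?_⟩
  obtain ⟨-, hr, ⟨v, hv, -, hAv⟩, -⟩ := rho_spec hp θ
  obtain ⟨-, hs, ⟨u, hu, -, hAu⟩, -⟩ := rho_spec hp φ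
  simp only [smul_eq_mul]
  rw [← Real.log_rpow hr, ← Real.log_rpow hs,
    ← Real.log_mul (Real.rpow_pos_of_pos hr a).ne' (Real.rpow_pos_of_pos hs b).ne']
  refine Real.log_le_log (rho_spec hp _).2.1 ?_
  have hx : ∀ i, 0 < v i ^ a * u i ^ b := fun i =>
    mul_pos (Real.rpow_pos_of_pos (hv i) a) (Real.rpow_pos_of_pos (hu i) b)
  refine rho_le_of_mulVec_le hp hx fun i => ?_
  have hvi : 0 < rho p θ * v i := mul_pos hr (hv i)
  have hui : 0 < rho p φ * u i := mul_pos hs (hu i)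
  have hterm : ∀ j, powMatrix p (a * θ + b * φ) i j * (v j ^ a * u j ^ b)
      ≤ (a * (powMatrix p θ i j * v j / (rho p θ * v i)) +
        b * (powMatrix p φ i j * u j / (rho p φ * u i))) *
        (rho p θ ^ a * rho p φ ^ b * (v i ^ a * u i ^ b)) := fun j => by
    rcases (hp.nonneg i j).eq_or_lt with h0 | h0
    · simp [powMatrix_apply, ← h0]
    · have hP : powMatrix p (a * θ + b * φ) i j
          = powMatrix p θ i j ^ a * powMatrix p φ i j ^ b := by
        simp only [powMatrix_apply, if_neg h0.ne']
        rw [Real.rpow_add h0, ← Real.rpow_mul h0.le, ← Real.rpow_mul h0.le, mul_comm a, mul_comm b]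
      have hPv := mul_pos (powMatrix_pos θ h0) (hv j)
      have hPu := mul_pos (powMatrix_pos φ h0) (hu j)
      have key := Real.geom_mean_le_arith_mean2_weighted ha hb (div_pos hPv hvi).le
        (div_pos hPu hui).le hab
      rw [Real.div_rpow hPv.le hvi.le, Real.div_rpow hPu.le hui.le,
        Real.mul_rpow hr.le (hv i).le, Real.mul_rpow hs.le (hu i).le,
        Real.mul_rpow (powMatrix_pos θ h0).le (hv j).le,
        Real.mul_rpow (powMatrix_pos φ h0).le (hu j).le] at key
      have hra := Real.rpow_pos_of_pos hr a
      have hsb := Real.rpow_pos_of_pos hs b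
      have hva := Real.rpow_pos_of_pos (hv i) a
      have hub := Real.rpow_pos_of_pos (hu i) b
      have hden : 0 < rho p θ ^ a * rho p φ ^ b * (v i ^ a * u i ^ b) := by positivity
      refine le_trans (le_of_eq ?_) (mul_le_mul_of_nonneg_right key hden.le)
      rw [hP]
      field_simp
  have hsum : ∑ j, (a * (powMatrix p θ i j * v j / (rho p θ * v i)) +
      b * (powMatrix p φ i j * u j / (rho p φ * u i))) = 1 := by
    have h1 := congrFun hAv i
    have h2 := congrFun hAu i
    simp only [Matrix.mulVec, dotProduct, Pi.smul_apply, smul_eq_mul] at h1 h2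
    rw [Finset.sum_add_distrib, ← Finset.mul_sum, ← Finset.mul_sum, ← Finset.sum_div,
      ← Finset.sum_div, h1, h2, div_self hvi.ne', div_self hui.ne', mul_one, mul_one, hab]
  exact (Finset.sum_le_sum fun j _ => hterm j).trans_eq
    (by rw [← Finset.sum_mul, hsum, one_mul])

theorem hasDerivAt_log_rho [NeZero K] {p : Matrix (Fin K) (Fin K) ℝ} (hp : p.IsPrimitive) (θ : ℝ) :
    HasDerivAt (fun θ => Real.log (rho p θ)) (deriv (rho p) θ / rho p θ) θ :=
  (differentiable_rho hp θ).hasDerivAt.log (rho_spec hp θ).2.1.ne'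

theorem monotone_deriv_rho_div_rho [NeZero K] {p : Matrix (Fin K) (Fin K) ℝ}
    (hp : p.IsPrimitive) : Monotone fun θ => deriv (rho p) θ / rho p θ := by
  have h := (convexOn_log_rho hp).monotoneOn_deriv
    fun θ _ => (hasDerivAt_log_rho hp θ).differentiableAt
  rw [monotoneOn_univ] at h
  exact fun x y hxy => by simpa only [(hasDerivAt_log_rho hp _).deriv] using h hxy

/-! ### Asymptotics of log ρ at ±∞. -/

/-- If the derivative of `f` is monotone with limit `l` at `+∞`, then `f θ / θ → l`. -/
theorem tendsto_div_of_monotone_deriv {f f' : ℝ → ℝ} (hf : ∀ θ, HasDerivAt f (f' θ) θ)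
    (hmono : Monotone f') {l : ℝ} (hl : Tendsto f' atTop (𝓝 l)) :
    Tendsto (fun θ => f θ / θ) atTop (𝓝 l) := by
  have hle : ∀ θ, f' θ ≤ l := fun θ => hmono.ge_of_tendsto hl θ
  have hmvt : ∀ a b, a < b → f' a * (b - a) ≤ f b - f a ∧ f b - f a ≤ l * (b - a) := by
    intro a b hab
    obtain ⟨c, hc, h⟩ := exists_hasDerivAt_eq_slope f f' hab
      (fun x _ => (hf x).continuousAt.continuousWithinAt) fun x _ => hf x
    rw [eq_div_iff (sub_pos.2 hab).ne'] at h
    rw [← h]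
    exact ⟨mul_le_mul_of_nonneg_right (hmono hc.1.le) (sub_pos.2 hab).le,
      mul_le_mul_of_nonneg_right (hle c) (sub_pos.2 hab).le⟩
  rw [tendsto_order]
  have hinv : ∀ c : ℝ, Tendsto (fun θ : ℝ => c / θ) atTop (𝓝 0) := fun c =>
    tendsto_const_nhds.div_atTop tendsto_id
  constructor
  · intro m hm
    obtain ⟨a, ha⟩ := ((tendsto_order.1 hl).1 m hm).exists
    have hlim : Tendsto (fun θ : ℝ => f' a + (f a - f' a * a) / θ) atTop (𝓝 (f' a)) := by
      simpa using (hinv _).const_add (f' a)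
    filter_upwards [(tendsto_order.1 hlim).1 m ha, eventually_gt_atTop a, eventually_gt_atTop 0]
      with θ h1 h2 h3
    refine h1.trans_le ?_
    rw [le_div_iff₀ h3, add_mul, div_mul_cancel₀ _ h3.ne']
    linarith [(hmvt a θ h2).1]
  · intro m hm
    have hlim : Tendsto (fun θ : ℝ => l + f 0 / θ) atTop (𝓝 l) := by
      simpa using (hinv _).const_add l
    filter_upwards [(tendsto_order.1 hlim).2 m hm, eventually_gt_atTop 0] with θ h1 h3
    refine lt_of_le_of_lt ?_ h1
    rw [div_le_iff₀ h3, add_mul, div_mul_cancel₀ _ h3.ne']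
    linarith [(hmvt 0 θ h3).2]

/-- If the derivative of `f` is monotone with limit `l` at `-∞`, then `f θ / θ → l`. -/
theorem tendsto_div_atBot_of_monotone_deriv {f f' : ℝ → ℝ} (hf : ∀ θ, HasDerivAt f (f' θ) θ)
    (hmono : Monotone f') {l : ℝ} (hl : Tendsto f' atBot (𝓝 l)) :
    Tendsto (fun θ => f θ / θ) atBot (𝓝 l) := by
  have h := tendsto_div_of_monotone_deriv (f := fun θ => f (-θ)) (f' := fun θ => -f' (-θ))
    (fun θ => by simpa [Function.comp_def] using (hf (-θ)).comp θ (hasDerivAt_neg θ))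
    (fun x y hxy => neg_le_neg (hmono (neg_le_neg hxy)))
    (hl.comp tendsto_neg_atTop_atBot).neg
  have h2 := (h.comp tendsto_neg_atBot_atTop).neg
  rw [neg_neg] at h2
  exact h2.congr fun θ => by simp [div_neg]

/-- For θ ≥ 1 the map x ↦ x^θ is superadditive on nonnegative reals, so summing θ-powers over paths
gives at most the θ-power of the sum. -/
theorem powMatrix_pow_le_rpow {p : Matrix (Fin K) (Fin K) ℝ} (hp : ∀ i j, 0 ≤ p i j) {θ : ℝ}
    (hθ : 1 ≤ θ) (m : ℕ) (i j : Fin K) : (powMatrix p θ ^ m) i j ≤ ((p ^ m) i j) ^ θ := by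
  have hθ0 : 0 < θ := zero_lt_one.trans_le hθ
  induction m generalizing j with
  | zero =>
    rcases eq_or_ne i j with rfl | h
    · simp
    · simp [h, Real.zero_rpow hθ0.ne']
  | succ m ih =>
    have hpm := Matrix.pow_apply_nonneg hp m
    have hterm : ∀ k, 0 ≤ (p ^ m) i k * p k j := fun k => mul_nonneg (hpm i k) (hp k j)
    simp only [pow_succ, Matrix.mul_apply]
    set S := ∑ k, (p ^ m) i k * p k j with hS
    have hS0 : 0 ≤ S := Finset.sum_nonneg fun k _ => hterm k
    have split : ∀ x : ℝ, 0 ≤ x → x ^ θ = x ^ (θ - 1) * x := fun x hx => by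
      conv_lhs => rw [← sub_add_cancel θ 1]
      rw [Real.rpow_add_of_nonneg hx (by linarith) zero_le_one, Real.rpow_one]
    calc ∑ k, (powMatrix p θ ^ m) i k * powMatrix p θ k j
        ≤ ∑ k, ((p ^ m) i k * p k j) ^ θ := Finset.sum_le_sum fun k _ => by
          rw [Real.mul_rpow (hpm i k) (hp k j)]
          refine mul_le_mul (ih k) ?_ (powMatrix_nonneg hp θ k j) (Real.rpow_nonneg (hpm i k) θ)
          rw [powMatrix_apply]
          split_ifs with h
          · exact Real.rpow_nonneg (hp k j) θ
          · exact le_rfl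
      _ ≤ ∑ k, S ^ (θ - 1) * ((p ^ m) i k * p k j) := Finset.sum_le_sum fun k _ => by
          rw [split _ (hterm k)]
          exact mul_le_mul_of_nonneg_right (Real.rpow_le_rpow (hterm k)
            (Finset.single_le_sum (fun k _ => hterm k) (Finset.mem_univ k)) (by linarith))
            (hterm k)
      _ = S ^ θ := by rw [← Finset.mul_sum, ← hS, split S hS0]

/-- `log ρ(θ)` decreases at least linearly at `+∞`. -/
theorem exists_log_rho_le (hK : 2 ≤ K) {p : Matrix (Fin K) (Fin K) ℝ}
    (hst : p ∈ Matrix.rowStochastic ℝ (Fin K)) (hp : p.IsPrimitive) :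
    ∃ c < 0, ∃ b : ℝ, ∀ θ, 1 ≤ θ → Real.log (rho p θ) ≤ c * θ + b := by
  have : NeZero K := ⟨by omega⟩
  have : Nontrivial (Fin K) := Fin.nontrivial_iff_two_le.2 hK
  obtain ⟨N, hN, hpos⟩ := hp.exists_pos_pow
  -- The rows of p^N sum to one and have at least two positive entries; this is where K ≥ 2 matters.
  have hlt : ∀ i j, (p ^ N) i j < 1 := fun i j => by
    obtain ⟨k, hk⟩ := exists_ne j
    rw [← Matrix.sum_row_of_mem_rowStochastic (pow_mem hst N) i]
    exact Finset.single_lt_sum hk (Finset.mem_univ _) (Finset.mem_univ _) (hpos i k)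
      fun k _ _ => (hpos i k).le
  obtain ⟨⟨a, b⟩, -, hab⟩ := Finset.exists_max_image (Finset.univ : Finset (Fin K × Fin K))
    (fun q => (p ^ N) q.1 q.2) Finset.univ_nonempty
  set δ := (p ^ N) a b
  have hN0 : (0 : ℝ) < N := by exact_mod_cast hN
  have hK0 : (0 : ℝ) < K := by exact_mod_cast (by omega : 0 < K)
  refine ⟨Real.log δ / N, div_neg_of_neg_of_pos (Real.log_neg (hpos a b) (hlt a b)) hN0,
    Real.log K / N, fun θ hθ => ?_⟩
  obtain ⟨-, hr, ⟨v, hv, hv1, hAv⟩, -⟩ := rho_spec hp θ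
  obtain ⟨i, -, hi⟩ := Finset.exists_max_image Finset.univ v Finset.univ_nonempty
  have hpow := congrFun (Matrix.pow_mulVec_of_mulVec hAv N) i
  simp only [Matrix.mulVec, dotProduct, Pi.smul_apply, smul_eq_mul] at hpow
  have hle : rho p θ ^ N ≤ K * δ ^ θ := by
    refine le_of_mul_le_mul_right ?_ (hv i)
    rw [← hpow]
    calc ∑ j, (powMatrix p θ ^ N) i j * v j ≤ ∑ _j : Fin K, δ ^ θ * v i :=
          Finset.sum_le_sum fun j hj => mul_le_mul
            ((powMatrix_pow_le_rpow hp.nonneg hθ N i j).trans (Real.rpow_le_rpow (hpos i j).le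
              (hab (i, j) (Finset.mem_univ _)) (by linarith))) (hi j hj) (hv j).le
            (Real.rpow_nonneg (hpos a b).le θ)
      _ = K * δ ^ θ * v i := by simp [mul_assoc]
  have hlog := Real.log_le_log (pow_pos hr N) hle
  rw [Real.log_pow, Real.log_mul hK0.ne' (Real.rpow_pos_of_pos (hpos a b) θ).ne',
    Real.log_rpow (hpos a b)] at hlog
  have : Real.log δ / N * θ + Real.log K / N = (Real.log K + θ * Real.log δ) / N := by ring
  rw [this, le_div_iff₀ hN0]
  linarith

/-- The limits of the logarithmic derivative of `ρ`. -/
theorem exists_limits_log_deriv (hK : 2 ≤ K) {p : Matrix (Fin K) (Fin K) ℝ}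
    (hst : p ∈ Matrix.rowStochastic ℝ (Fin K)) (hp : p.IsPrimitive) :
    ∃ l L : ℝ, l ≤ L ∧ L < 0 ∧
      Tendsto (fun θ => deriv (rho p) θ / rho p θ) atBot (𝓝 l) ∧
      Tendsto (fun θ => deriv (rho p) θ / rho p θ) atTop (𝓝 L) ∧
      Tendsto (fun θ => Real.log (rho p θ) / θ) atBot (𝓝 l) ∧
      Tendsto (fun θ => Real.log (rho p θ) / θ) atTop (𝓝 L) := by
  have : NeZero K := ⟨by omega⟩
  obtain ⟨m, hm⟩ := exists_le_deriv_rho_div_rho hp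
  obtain ⟨c, hc, b, hb⟩ := exists_log_rho_le hK hst hp
  have hmono := monotone_deriv_rho_div_rho hp
  have hder := hasDerivAt_log_rho hp
  have hbot := tendsto_atBot_ciInf hmono ⟨m, by rintro _ ⟨θ, rfl⟩; exact hm θ⟩
  -- A slope d > c at θ would persist by monotonicity, and log ρ would outgrow the linear bound c t
  -- + b.
  have hgrow : ∀ θ, deriv (rho p) θ / rho p θ ≤ c := fun θ => by
    set d := deriv (rho p) θ / rho p θ with hd
    by_contra! hlt
    have hlin : ∀ t, θ < t → d * (t - θ) ≤ Real.log (rho p t) - Real.log (rho p θ) := by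
      intro t ht
      obtain ⟨x, hx, h⟩ := exists_hasDerivAt_eq_slope _ _ ht
        (fun x _ => (hder x).continuousAt.continuousWithinAt) fun x _ => hder x
      rw [eq_div_iff (sub_pos.2 ht).ne'] at h
      rw [← h]
      exact mul_le_mul_of_nonneg_right (hmono hx.1.le) (sub_pos.2 ht).le
    have htop : Tendsto (fun t : ℝ => (d - c) * t) atTop atTop :=
      tendsto_id.const_mul_atTop (sub_pos.2 hlt)
    obtain ⟨t, h1, h2, h3⟩ := ((htop.eventually_gt_atTop
      (b + d * θ - Real.log (rho p θ))).and
      ((eventually_gt_atTop θ).and (eventually_ge_atTop 1))).exists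
    linarith [hlin t h2, hb t h3]
  have htop := tendsto_atTop_ciSup hmono ⟨c, by rintro _ ⟨θ, rfl⟩; exact hgrow θ⟩
  exact ⟨_, _, (hmono.le_of_tendsto hbot 0).trans (hmono.ge_of_tendsto htop 0),
    (ciSup_le hgrow).trans_lt hc, hbot, htop,
    tendsto_div_atBot_of_monotone_deriv hder hmono hbot,
    tendsto_div_of_monotone_deriv hder hmono htop⟩

/-! ### Power sums of box sizes and extreme boxes. -/

theorem boxSize_nonneg {p : Matrix (Fin K) (Fin K) ℝ} (hp : ∀ i j, 0 ≤ p i j) (i₀ : Fin K) {n : ℕ}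
    (u : Fin n → Fin K) : 0 ≤ boxSize p i₀ u := by
  induction n with
  | zero => simp [boxSize]
  | succ n ih => exact mul_nonneg (ih _) (hp _ _)

/-- Sums of powers of box sizes, weighted by type, are given by powers of `A(θ)`. -/
theorem sum_boxSize_rpow {p : Matrix (Fin K) (Fin K) ℝ} (hp : ∀ i j, 0 ≤ p i j) (i₀ : Fin K)
    (θ : ℝ) (n : ℕ) (x : Fin K → ℝ) :
    ∑ u : Fin n → Fin K, (if boxSize p i₀ u = 0 then 0 else boxSize p i₀ u ^ θ) *
      x (boxType i₀ u) = (powMatrix p θ ^ n).mulVec x i₀ := by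
  induction n generalizing x with
  | zero => simp [boxSize, boxType]
  | succ n ih =>
    rw [pow_succ, ← Matrix.mulVec_mulVec, ← ih]
    rw [← (Fin.snocEquiv fun _ : Fin (n + 1) => Fin K).sum_comp, Fintype.sum_prod_type,
      Finset.sum_comm]
    refine Finset.sum_congr rfl fun u _ => ?_
    simp only [Matrix.mulVec, dotProduct, Finset.mul_sum]
    refine Finset.sum_congr rfl fun k _ => ?_
    have h1 : boxType i₀ (Fin.snoc u k : Fin (n + 1) → Fin K) = k := by simp [boxType]
    rw [show (Fin.snocEquiv fun _ : Fin (n + 1) => Fin K) (k, u)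
      = (Fin.snoc u k : Fin (n + 1) → Fin K) from rfl, boxSize_snoc, h1, powMatrix_apply,
      ← mul_assoc]
    congr 1
    by_cases h2 : boxSize p i₀ u = 0
    · simp [h2]
    by_cases h3 : p (boxType i₀ u) k = 0
    · simp [h3]
    · rw [if_neg (mul_ne_zero h2 h3), if_neg h2, if_neg h3,
        Real.mul_rpow (boxSize_nonneg hp i₀ u) (hp _ _)]

theorem finite_boxSizes (p : Matrix (Fin K) (Fin K) ℝ) (i₀ : Fin K) (n : ℕ) :
    (boxSizes p i₀ n).Finite :=
  (Set.finite_range fun u : Fin n → Fin K => boxSize p i₀ u).subset fun _ hx => hx.2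

/-- The eigenvector-weighted power sum is ρ(1)^n v(i₀) > 0, so some word has nonzero size. -/
theorem nonempty_boxSizes [NeZero K] {p : Matrix (Fin K) (Fin K) ℝ} (hp : p.IsPrimitive)
    (i₀ : Fin K) (n : ℕ) : (boxSizes p i₀ n).Nonempty := by
  obtain ⟨-, hr, ⟨v, hv, -, hAv⟩, -⟩ := rho_spec hp 1
  have h := sum_boxSize_rpow hp.nonneg i₀ 1 n v
  rw [Matrix.pow_mulVec_of_mulVec hAv] at h
  obtain ⟨u, -, hu⟩ := Finset.exists_ne_zero_of_sum_ne_zero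
    (h.trans_ne (mul_pos (pow_pos hr n) (hv i₀)).ne')
  have h0 : boxSize p i₀ u ≠ 0 := fun h0 => by simp [h0] at hu
  exact ⟨_, (boxSize_nonneg hp.nonneg i₀ u).lt_of_ne' h0, u, rfl⟩

theorem isLeast_smallestBox [NeZero K] {p : Matrix (Fin K) (Fin K) ℝ} (hp : p.IsPrimitive)
    (i₀ : Fin K) (n : ℕ) : IsLeast (boxSizes p i₀ n) (smallestBox p i₀ n) :=
  ⟨(nonempty_boxSizes hp i₀ n).csInf_mem (finite_boxSizes p i₀ n),
    fun _ hx => csInf_le (finite_boxSizes p i₀ n).bddBelow hx⟩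

theorem isGreatest_largestBox [NeZero K] {p : Matrix (Fin K) (Fin K) ℝ} (hp : p.IsPrimitive)
    (i₀ : Fin K) (n : ℕ) : IsGreatest (boxSizes p i₀ n) (largestBox p i₀ n) :=
  ⟨(nonempty_boxSizes hp i₀ n).csSup_mem (finite_boxSizes p i₀ n),
    fun _ hx => le_csSup (finite_boxSizes p i₀ n).bddAbove hx⟩

/-- Two-sided bound for the box whose `θ`-th power is the largest. -/
theorem exists_log_boxSize_bounds [NeZero K] {p : Matrix (Fin K) (Fin K) ℝ} (hp : p.IsPrimitive)
    (i₀ : Fin K) (θ : ℝ) : ∃ c : ℝ, ∀ (n : ℕ), ∀ s ∈ boxSizes p i₀ n,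
      (∀ x ∈ boxSizes p i₀ n, x ^ θ ≤ s ^ θ) →
        n * (Real.log (rho p θ) - Real.log K) - c ≤ θ * Real.log s ∧
          θ * Real.log s ≤ n * Real.log (rho p θ) + c := by
  obtain ⟨-, hr, ⟨v, hv, hv1, hAv⟩, -⟩ := rho_spec hp θ
  obtain ⟨a, -, ha⟩ := Finset.exists_min_image Finset.univ v Finset.univ_nonempty
  refine ⟨-Real.log (v a), fun n s hs hmax => ?_⟩
  have hv_le := le_one_of_sum_eq_one hv hv1
  have hsum := sum_boxSize_rpow hp.nonneg i₀ θ n v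
  rw [Matrix.pow_mulVec_of_mulVec hAv, Pi.smul_apply, smul_eq_mul] at hsum
  have hK0 : (0 : ℝ) < K := by exact_mod_cast NeZero.pos K
  have hsθ : 0 < s ^ θ := Real.rpow_pos_of_pos hs.1 θ
  have hterm : ∀ u : Fin n → Fin K, 0 ≤ (if boxSize p i₀ u = 0 then 0 else boxSize p i₀ u ^ θ) *
      v (boxType i₀ u) := fun u => by
    refine mul_nonneg ?_ (hv _).le
    split_ifs
    exacts [le_rfl, Real.rpow_nonneg (boxSize_nonneg hp.nonneg i₀ u) θ]
  -- Bounding each of the K^n words by the maximal term costs log K per generation, independently of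
  -- θ; the reverse bound keeps a single term.
  have hupper : rho p θ ^ n * v a ≤ (K : ℝ) ^ n * s ^ θ := by
    calc rho p θ ^ n * v a ≤ rho p θ ^ n * v i₀ :=
          mul_le_mul_of_nonneg_left (ha i₀ (Finset.mem_univ _)) (pow_pos hr n).le
      _ ≤ ∑ _u : Fin n → Fin K, s ^ θ := hsum ▸ Finset.sum_le_sum fun u _ => by
          split_ifs with h
          · simpa using hsθ.le
          · exact (mul_le_of_le_one_right (Real.rpow_nonneg (boxSize_nonneg hp.nonneg i₀ u) θ)
              (hv_le _)).trans
              (hmax _ ⟨(boxSize_nonneg hp.nonneg i₀ u).lt_of_ne' h, u, rfl⟩)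
      _ = (K : ℝ) ^ n * s ^ θ := by simp
  have hlower : s ^ θ * v a ≤ rho p θ ^ n := by
    obtain ⟨hs0, u, rfl⟩ := hs
    calc boxSize p i₀ u ^ θ * v a ≤ boxSize p i₀ u ^ θ * v (boxType i₀ u) :=
          mul_le_mul_of_nonneg_left (ha _ (Finset.mem_univ _)) hsθ.le
      _ ≤ rho p θ ^ n * v i₀ := by
          rw [← hsum]
          refine le_trans (le_of_eq ?_)
            (Finset.single_le_sum (fun u _ => hterm u) (Finset.mem_univ u))
          rw [if_neg hs0.ne']
      _ ≤ rho p θ ^ n := mul_le_of_le_one_right (pow_pos hr n).le (hv_le _)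
  have h1 := Real.log_le_log (mul_pos (pow_pos hr n) (hv a)) hupper
  have h2 := Real.log_le_log (mul_pos hsθ (hv a)) hlower
  rw [Real.log_mul (pow_pos hr n).ne' (hv a).ne', Real.log_mul (pow_pos hK0 n).ne' hsθ.ne',
    Real.log_pow, Real.log_pow, Real.log_rpow hs.1] at h1
  rw [Real.log_mul hsθ.ne' (hv a).ne', Real.log_pow, Real.log_rpow hs.1] at h2
  constructor <;> linarith

/-! ### Exponential rates of the extreme boxes. -/

/-- A sequence whose multiples by every `θ > 0` grow at a rate between `f θ - κ` and `f θ` has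
rate `lim f θ / θ`. -/
theorem tendsto_div_of_linear_bounds {a : ℕ → ℝ} {f : ℝ → ℝ} {κ l : ℝ}
    (hf : Tendsto (fun θ => f θ / θ) atTop (𝓝 l))
    (h : ∀ θ > 0, ∃ c : ℝ, ∀ n : ℕ, n * (f θ - κ) - c ≤ θ * a n ∧ θ * a n ≤ n * f θ + c) :
    Tendsto (fun n : ℕ => a n / n) atTop (𝓝 l) := by
  have hinv : ∀ c : ℝ, Tendsto (fun n : ℕ => c / (n : ℝ)) atTop (𝓝 0) := fun c =>
    tendsto_const_nhds.div_atTop tendsto_natCast_atTop_atTop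
  -- The loss κ is divided by θ, so one large θ, fixed before n → ∞, makes it negligible.
  have hf' : Tendsto (fun θ => (f θ - κ) / θ) atTop (𝓝 l) := by
    simpa [sub_div] using hf.sub (tendsto_const_nhds.div_atTop tendsto_id : Tendsto
      (fun θ : ℝ => κ / θ) atTop (𝓝 0))
  rw [tendsto_order]
  constructor
  · intro m hm
    obtain ⟨θ, h1, h0⟩ := (((tendsto_order.1 hf').1 m hm).and (eventually_gt_atTop 0)).exists
    obtain ⟨c, hc⟩ := h θ h0
    have hlim : Tendsto (fun n : ℕ => (f θ - κ) / θ - c / θ / (n : ℝ)) atTop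
        (𝓝 ((f θ - κ) / θ)) := by
      simpa using (hinv (c / θ)).const_sub ((f θ - κ) / θ)
    filter_upwards [(tendsto_order.1 hlim).1 m h1, eventually_gt_atTop 0] with n h2 h3
    have h3' : (0 : ℝ) < n := by exact_mod_cast h3
    refine h2.trans_le ?_
    rw [le_div_iff₀ h3', sub_mul, div_mul_cancel₀ _ h3'.ne', div_mul_eq_mul_div, ← sub_div,
      div_le_iff₀ h0]
    linarith [(hc n).1]
  · intro m hm
    obtain ⟨θ, h1, h0⟩ := (((tendsto_order.1 hf).2 m hm).and (eventually_gt_atTop 0)).exists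
    obtain ⟨c, hc⟩ := h θ h0
    have hlim : Tendsto (fun n : ℕ => f θ / θ + c / θ / (n : ℝ)) atTop (𝓝 (f θ / θ)) := by
      simpa using (hinv (c / θ)).const_add (f θ / θ)
    filter_upwards [(tendsto_order.1 hlim).2 m h1, eventually_gt_atTop 0] with n h2 h3
    have h3' : (0 : ℝ) < n := by exact_mod_cast h3
    refine lt_of_le_of_lt ?_ h2
    rw [div_le_iff₀ h3', add_mul, div_mul_cancel₀ _ h3'.ne', div_mul_eq_mul_div, ← add_div,
      le_div_iff₀ h0]
    linarith [(hc n).2]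

theorem tendsto_log_largestBox_div [NeZero K] {p : Matrix (Fin K) (Fin K) ℝ} (hp : p.IsPrimitive)
    (i₀ : Fin K) {L : ℝ} (hL : Tendsto (fun θ => Real.log (rho p θ) / θ) atTop (𝓝 L)) :
    Tendsto (fun n : ℕ => Real.log (largestBox p i₀ n) / n) atTop (𝓝 L) := by
  refine tendsto_div_of_linear_bounds (κ := Real.log K) hL fun θ hθ => ?_
  obtain ⟨c, hc⟩ := exists_log_boxSize_bounds hp i₀ θ
  have hmax := isGreatest_largestBox hp i₀
  exact ⟨c, fun n => hc n _ (hmax n).1 fun x hx =>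
    Real.rpow_le_rpow hx.1.le ((hmax n).2 hx) hθ.le⟩

/-- Negative exponents reverse order, so the smallest box maximizes the power; the linear bounds are
applied to minus its logarithm with θ replaced by -θ. -/
theorem tendsto_log_smallestBox_div [NeZero K] {p : Matrix (Fin K) (Fin K) ℝ} (hp : p.IsPrimitive)
    (i₀ : Fin K) {l : ℝ} (hl : Tendsto (fun θ => Real.log (rho p θ) / θ) atBot (𝓝 l)) :
    Tendsto (fun n : ℕ => Real.log (smallestBox p i₀ n) / n) atTop (𝓝 l) := by
  have hl' : Tendsto (fun θ => Real.log (rho p (-θ)) / θ) atTop (𝓝 (-l)) :=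
    (hl.comp tendsto_neg_atTop_atBot).neg.congr fun θ => by simp [div_neg]
  have hmin := isLeast_smallestBox hp i₀
  have h := tendsto_div_of_linear_bounds (κ := Real.log K)
    (a := fun n => -Real.log (smallestBox p i₀ n)) hl' fun θ hθ => by
      obtain ⟨c, hc⟩ := exists_log_boxSize_bounds hp i₀ (-θ)
      refine ⟨c, fun n => ?_⟩
      rw [mul_neg, ← neg_mul]
      exact hc n _ (hmin n).1 fun x hx =>
        Real.rpow_le_rpow_of_nonpos (hmin n).1.1 ((hmin n).2 hx) (neg_nonpos.2 hθ.le)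
  simpa [neg_div] using h.neg

end MarkovBoxes

theorem mainTheorem8 (K : ℕ) (hK : 2 ≤ K) (p : Matrix (Fin K) (Fin K) ℝ)
    (hp : p ∈ Matrix.rowStochastic ℝ (Fin K)) (hirr : p.IsIrreducible)
    (haper : MarkovBoxes.IsAperiodic p) (i₀ : Fin K) :
    -- `ρ(θ)` and the quotient `ρ(θ) / (-ρ'(θ))` are well defined
    (∀ θ : ℝ, MarkovBoxes.IsMaxModulusEigenvalue (MarkovBoxes.powMatrix p θ)
        (MarkovBoxes.rho p θ)) ∧
    Differentiable ℝ (MarkovBoxes.rho p) ∧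
    (∀ θ : ℝ, deriv (MarkovBoxes.rho p) θ < 0) ∧
    -- the smallest and the largest box exist
    (∀ n : ℕ, IsLeast (MarkovBoxes.boxSizes p i₀ n) (MarkovBoxes.smallestBox p i₀ n)) ∧
    (∀ n : ℕ, IsGreatest (MarkovBoxes.boxSizes p i₀ n) (MarkovBoxes.largestBox p i₀ n)) ∧
    -- `c` is `C_*` and `C` is `C^*`
    ∃ c C : ℝ,
      Tendsto (fun θ : ℝ => MarkovBoxes.rho p θ / (-deriv (MarkovBoxes.rho p) θ)) atBot (𝓝 c) ∧
      Tendsto (fun θ : ℝ => MarkovBoxes.rho p θ / (-deriv (MarkovBoxes.rho p) θ)) atTop (𝓝 C) ∧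
      0 < c ∧ c ≤ C ∧
      Tendsto (fun n : ℕ => Real.log (MarkovBoxes.smallestBox p i₀ n) / n) atTop (𝓝 (-1 / c)) ∧
      Tendsto (fun n : ℕ => Real.log (MarkovBoxes.largestBox p i₀ n) / n) atTop (𝓝 (-1 / C)) := by
  have : NeZero K := ⟨by omega⟩
  have hprim := MarkovBoxes.isPrimitive_of_isIrreducible_of_isAperiodic hirr haper
  obtain ⟨l, L, hlL, hL, hbot, htop, hbot', htop'⟩ := MarkovBoxes.exists_limits_log_deriv hK hp hprim
  have hl : l < 0 := hlL.trans_lt hL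
  -- The monotone quotient ρ'/ρ stays below its limit L < 0 at +∞.
  have hneg : ∀ θ, deriv (MarkovBoxes.rho p) θ < 0 := fun θ => by
    have h := ((MarkovBoxes.monotone_deriv_rho_div_rho hprim).ge_of_tendsto htop θ).trans_lt hL
    exact neg_of_div_neg_left h (MarkovBoxes.rho_spec hprim θ).2.1.le
  have hquot : ∀ θ, -(deriv (MarkovBoxes.rho p) θ / MarkovBoxes.rho p θ)⁻¹
      = MarkovBoxes.rho p θ / (-deriv (MarkovBoxes.rho p) θ) := fun θ => by
    rw [inv_div, div_neg]
  refine ⟨fun θ => (MarkovBoxes.rho_spec hprim θ).1, MarkovBoxes.differentiable_rho hprim, hneg,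
    MarkovBoxes.isLeast_smallestBox hprim i₀, MarkovBoxes.isGreatest_largestBox hprim i₀,
    -l⁻¹, -L⁻¹, (hbot.inv₀ hl.ne).neg.congr hquot, (htop.inv₀ hL.ne).neg.congr hquot,
    neg_pos.2 (inv_lt_zero.2 hl), neg_le_neg ((inv_le_inv_of_neg hL hl).2 hlL), ?_, ?_⟩
  · simpa [neg_div_neg_eq] using MarkovBoxes.tendsto_log_smallestBox_div hprim i₀ hbot'
  · simpa [neg_div_neg_eq] using MarkovBoxes.tendsto_log_largestBox_div hprim i₀ htop'
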